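/- All rings are associative with unity, and subrings contain the unity of the overring. For a ring $T$ let $\mathcal P(T)$ be its prime radical (the intersection of all prime ideals of $T$) and let $$\mathcal E_{\mathcal P}=\{e=e^2\in T : e+\mathcal P(T)\text{ is central in }T/\mathcal P(T)\}.$$ Let $R$ be a subring of a ring $T$, let $\emptyset\neq\mathcal E\subseteq\mathcal E_{\mathcal P}$, and let $S$ be the subring of $T$ generated by $R\cup\mathcal E$. Then: 1. $\rho(R)=\rho(S)\cap R$ for every special radical $\rho$. 2. $R$ and $S$ have the same classical Krull dimension, both when it is understood as the supremum of the lengths of finite chains of prime ideals and in the ordinal-valued sense (one of the two ordinal-valued dimensions exists if and only if the other does, and then they are equal). 3. If $S$ is von Neumann regular, then so is $R$. Here a class $\mathcal M$ of associative, not necessarily unital rings, closed under isomorphism, is *special* if it consists of prime rings (rings in which $IJ=0$ for ideals $I,J$ implies $I=0$ or $J=0$), contains every ideal of each of its members, and contains every ring $A$ having an essential ideal $I$ (an ideal that meets every nonzero ideal of $A$ nontrivially) with $I\in\mathcal M$. A *special radical* $\rho$ is the upper radical of a special class $\mathcal M$: the class of all rings with no nonzero homomorphic image in $\mathcal M$.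 For a ring $A$, $\rho(A)$ is the sum of all ideals of $A$ that, regarded as rings, belong to $\rho$. The ordinal-valued classical Krull dimension of $A$ is the least $\alpha$ (an ordinal or $-1$), if there is one, such that $X_\alpha$ is the set of all prime ideals, where $X_{-1}=\emptyset$ and, for an ordinal $\alpha$, $X_\alpha$ is the set of prime ideals $P$ such that every prime ideal properly containing $P$ lies in $X_\beta$ for some $\beta<\alpha$. -/

import Mathlib

universe u

/-! ### Prime ideals, the prime radical, classical Krull dimension -/

/-- A two-sided ideal `P` of a ring is prime if it is proper and, for all two-sided ideals
`I`, `J`, the inclusion `I J ⊆ P` implies `I ⊆ P` or `J ⊆ P`. -/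
structure IsPrimeIdeal {A : Type u} [Ring A] (P : TwoSidedIdeal A) : Prop where
  ne_top : P ≠ ⊤
  le_or_le : ∀ I J : TwoSidedIdeal A,
    (∀ a ∈ I, ∀ b ∈ J, a * b ∈ P) → I ≤ P ∨ J ≤ P

/-- The set of all prime two-sided ideals of `A`, ordered by inclusion. -/
abbrev PrimeSpec (A : Type u) [Ring A] : Type u := {P : TwoSidedIdeal A // IsPrimeIdeal P}

/-- The prime radical: the intersection of all prime ideals. -/
def primeRadical (A : Type u) [Ring A] : TwoSidedIdeal A := sInf {P | IsPrimeIdeal P}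

/-- The set of idempotents of `T` whose image in `T / P(T)` is central, where `P(T)` is the
prime radical of `T`. -/
def centralModPrimeRadical (T : Type u) [Ring T] : Set T :=
  {e | IsIdempotentElem e ∧
    (primeRadical T).ringCon.mk' e ∈ Subring.center (primeRadical T).ringCon.Quotient}

/-- The transfinite filtration of the prime spectrum: level `-1` (written `⊥`) is empty, and for
an ordinal `d` a prime `P` lies in level `d` if every prime strictly containing `P` lies in
some level `b < d`. -/
def primeLevel (A : Type u) [Ring A] (d : WithBot Ordinal.{u}) : Set (PrimeSpec A) :=
  {P | d ≠ ⊥ ∧ ∀ Q : PrimeSpec A, P < Q → ∃ b, ∃ _ : b < d, Q ∈ primeLevel A b}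
termination_by (wellFounded_lt : WellFounded ((· < ·) : WithBot Ordinal.{u} → _ → Prop)).wrap d
decreasing_by assumption

theorem mem_primeLevel {A : Type u} [Ring A] {d : WithBot Ordinal.{u}} {P : PrimeSpec A} :
    P ∈ primeLevel A d ↔
      d ≠ ⊥ ∧ ∀ Q : PrimeSpec A, P < Q → ∃ b < d, Q ∈ primeLevel A b := by
  rw [primeLevel]
  simp only [Set.mem_ofPred_eq, exists_prop]

/-- `d` is the (ordinal-valued) classical Krull dimension of `A`: the least `d` such that every
prime ideal lies in level `d`. It need not exist; it is `-1` (that is, `⊥`) for the zero ring. -/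
def IsClassicalKrullDim (A : Type u) [Ring A] (d : WithBot Ordinal.{u}) : Prop :=
  IsLeast {c | primeLevel A c = Set.univ} d

/-- The classical Krull dimension as the supremum of the lengths of finite chains
`P₀ ⊊ P₁ ⊊ ⋯ ⊊ Pₙ` of prime ideals (`⊥` if there is no prime ideal, `⊤` if the lengths are
unbounded). -/
noncomputable def chainKrullDim (A : Type u) [Ring A] : WithBot ℕ∞ :=
  Order.krullDim (PrimeSpec A)

/-! ### Von Neumann regular rings -/

/-- A ring is von Neumann regular if every `a` has some `x` with `a x a = a`. -/
def IsVonNeumannRegular (A : Type u) [Ring A] : Prop := ∀ a : A, ∃ x : A, a * x * a = a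

/-! ### Special radicals (in the class of all associative rings, with or without unity) -/

/-- A class of associative, not necessarily unital rings. -/
abbrev RingClass : Type (u + 1) := ∀ (A : Type u) [NonUnitalRing A], Prop

/-- A ring is prime if `I J = 0` implies `I = 0` or `J = 0` for two-sided ideals `I`, `J`. -/
def IsPrimeRng (A : Type u) [NonUnitalRing A] : Prop :=
  ∀ I J : TwoSidedIdeal A, (∀ a ∈ I, ∀ b ∈ J, a * b = 0) → I = ⊥ ∨ J = ⊥

/-- An ideal is essential if it meets every nonzero ideal nontrivially. -/
def IsEssentialIdeal {A : Type u} [NonUnitalRing A] (I : TwoSidedIdeal A) : Prop :=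
  ∀ J : TwoSidedIdeal A, J ⊓ I = ⊥ → J = ⊥

/-- A special class of rings: an isomorphism-closed class of prime rings that is hereditary
(closed under ideals) and closed under essential extensions. -/
structure IsSpecialClass (M : RingClass.{u}) : Prop where
  iso : ∀ (A B : Type u) [NonUnitalRing A] [NonUnitalRing B], A ≃+* B → M A → M B
  prime : ∀ (A : Type u) [NonUnitalRing A], M A → IsPrimeRng A
  hereditary : ∀ (A : Type u) [NonUnitalRing A] (I : TwoSidedIdeal A), M A → M I
  essential : ∀ (A : Type u) [NonUnitalRing A] (I : TwoSidedIdeal A),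
    IsEssentialIdeal I → M I → M A

/-- The upper radical class of `M`: the rings without nonzero homomorphic images in `M`. -/
def upperRadical (M : RingClass.{u}) : RingClass.{u} := fun A _ =>
  ∀ (B : Type u) [NonUnitalRing B] (f : A →ₙ+* B), Function.Surjective f → M B → Subsingleton B

/-- A special radical is the upper radical class of a special class. -/
def IsSpecialRadical (ρ : RingClass.{u}) : Prop :=
  ∃ M : RingClass.{u}, IsSpecialClass M ∧ ρ = upperRadical M

/-- The `ρ`-radical of a ring `A`: the sum of all ideals of `A` which, regarded as rings, belong
to the radical class `ρ`. -/
def radicalIdeal (ρ : RingClass.{u}) (A : Type u) [NonUnitalRing A] : TwoSidedIdeal A :=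
  sSup {I : TwoSidedIdeal A | ρ I}

/-! Everything follows from one fact: for each prime `Q` of `S`, the map `R → S/Q` is onto
(`surjectiveModPrimes_inclusion`). Zorn's lemma gives a prime of `T` whose trace on `S` lies in `Q`,
so `Q` contains the commutators of elements of `S` with `e ∈ E`. Hence `e` is a central idempotent
of the prime ring `S/Q`, that is, 0 or 1.

Contraction of primes from `S` to `R` is therefore defined, strictly monotone and onto, with going
up (`exists_comap_eq`), and induces `R/(Q ∩ R) ≅ S/Q`. This transfers both Krull dimensions. A
special radical is the intersection of the kernels of surjections onto members of the special class
(`IsSpecialClass.mem_radicalIdeal_iff`). Proper kernels are prime, so `R` and `S` have the same such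
images.

If `S` is regular, its primes intersect in 0, so `E` is central in `S`. A quasi-inverse in `S` then
agrees with elements of `R` on finitely many central pieces, and these are patched inside `R`
(`exists_mul_mul_eq_of_local`). -/

/-! ### Existence of prime ideals and elementwise primeness -/

open TwoSidedIdeal in
/-- An ideal maximal among those avoiding a set `X` is prime if `X` meets the product of any two
ideals meeting `X`. -/
theorem exists_isPrimeIdeal_disjoint {A : Type u} [Ring A] (X : Set A) (hX : X.Nonempty)
    (hmul : ∀ I J : TwoSidedIdeal A, (∃ a ∈ I, a ∈ X) → (∃ b ∈ J, b ∈ X) →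
      ∃ a ∈ I, ∃ b ∈ J, a * b ∈ X)
    (I₀ : TwoSidedIdeal A) (hI₀ : ∀ a ∈ I₀, a ∉ X) :
    ∃ Q : TwoSidedIdeal A, IsPrimeIdeal Q ∧ I₀ ≤ Q ∧ (∀ a ∈ Q, a ∉ X) ∧
      ∀ J : TwoSidedIdeal A, Q ≤ J → (∀ a ∈ J, a ∉ X) → J ≤ Q := by
  obtain ⟨Q, hQ₀, hQ⟩ := zorn_le_nonempty₀ {I : TwoSidedIdeal A | ∀ a ∈ I, a ∉ X}
    (by
      intro c hc hchain I hI
      refine ⟨mk' {a | ∃ J ∈ c, a ∈ J} ⟨I, hI, I.zero_mem⟩ ?_ ?_ ?_ ?_, ?_, ?_⟩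
      · rintro x y ⟨J, hJ, hx⟩ ⟨K, hK, hy⟩
        rcases hchain.total hJ hK with h | h
        · exact ⟨K, hK, K.add_mem (h hx) hy⟩
        · exact ⟨J, hJ, J.add_mem hx (h hy)⟩
      · rintro x ⟨J, hJ, hx⟩
        exact ⟨J, hJ, J.neg_mem hx⟩
      · rintro x y ⟨J, hJ, hy⟩
        exact ⟨J, hJ, J.mul_mem_left _ _ hy⟩
      · rintro x y ⟨J, hJ, hx⟩
        exact ⟨J, hJ, J.mul_mem_right _ _ hx⟩
      · intro a ha
        rw [mem_mk'] at ha
        obtain ⟨J, hJ, haJ⟩ := ha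
        exact hc hJ a haJ
      · intro J hJ a ha
        rw [mem_mk']
        exact ⟨J, hJ, ha⟩) I₀ hI₀
  have hmax : ∀ J : TwoSidedIdeal A, Q ≤ J → (∀ a ∈ J, a ∉ X) → J ≤ Q :=
    fun J hJ hJX => hQ.2 hJX hJ
  refine ⟨Q, ⟨?_, ?_⟩, hQ₀, hQ.1, hmax⟩
  · rintro rfl
    obtain ⟨x, hx⟩ := hX
    exact hQ.1 x (mem_top A) hx
  · intro I J hIJ
    by_contra! hcon
    have key : ∀ K : TwoSidedIdeal A, ¬ K ≤ Q → ∃ a ∈ K ⊔ Q, a ∈ X := by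
      intro K hK
      by_contra! h
      exact hK (le_sup_left.trans (hmax _ le_sup_right h))
    obtain ⟨a, ha, b, hb, hab⟩ := hmul _ _ (key I hcon.1) (key J hcon.2)
    refine hQ.1 _ ?_ hab
    obtain ⟨i, hi, q, hq, rfl⟩ := mem_sup.1 ha
    obtain ⟨j, hj, q', hq', rfl⟩ := mem_sup.1 hb
    rw [add_mul, mul_add]
    exact Q.add_mem (Q.add_mem (hIJ _ hi _ hj) (Q.mul_mem_left _ _ hq')) (Q.mul_mem_right _ _ hq)

/-- The elementwise form of primeness of an ideal. -/
theorem IsPrimeIdeal.mem_or_mem {A : Type u} [Ring A] {P : TwoSidedIdeal A} (hP : IsPrimeIdeal P)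
    {x y : A} (h : ∀ c, x * c * y ∈ P) : x ∈ P ∨ y ∈ P := by
  -- `y ∈ W`, and `x` lies in the left annihilator `V` of `W` modulo `P`; primeness is applied to `V
  -- * W ⊆ P`.
  let W : TwoSidedIdeal A := .mk' {b | ∀ c, x * c * b ∈ P}
    (fun c => by simp)
    (fun ha hb c => by rw [mul_add]; exact P.add_mem (ha c) (hb c))
    (fun ha c => by rw [mul_neg]; exact P.neg_mem (ha c))
    (fun {d b} hb c => by
      have := hb (c * d)
      rwa [show x * c * (d * b) = x * (c * d) * b by simp only [mul_assoc]])
    (fun ha c => by rw [← mul_assoc]; exact P.mul_mem_right _ _ (ha c))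
  have hW : ∀ b, b ∈ W ↔ ∀ c, x * c * b ∈ P := fun b => TwoSidedIdeal.mem_mk' ..
  let V : TwoSidedIdeal A := .mk' {b | ∀ w ∈ W, b * w ∈ P}
    (fun w _ => by simp)
    (fun ha hb w hw => by rw [add_mul]; exact P.add_mem (ha w hw) (hb w hw))
    (fun ha w hw => by rw [neg_mul]; exact P.neg_mem (ha w hw))
    (fun ha w hw => by rw [mul_assoc]; exact P.mul_mem_left _ _ (ha w hw))
    (fun ha w hw => by rw [mul_assoc]; exact ha _ (W.mul_mem_left _ _ hw))
  have hV : ∀ b, b ∈ V ↔ ∀ w ∈ W, b * w ∈ P := fun b => TwoSidedIdeal.mem_mk' ..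
  rcases hP.le_or_le V W fun a ha b hb => (hV a).1 ha b hb with hle | hle
  · exact .inl (hle ((hV x).2 fun w hw => by simpa using (hW w).1 hw 1))
  · exact .inr (hle ((hW y).2 h))

/-- The elementwise form of primeness of a ring without unity. -/
theorem IsPrimeRng.eq_zero_or_eq_zero {A : Type u} [NonUnitalRing A] (hA : IsPrimeRng A)
    {x y : A} (h : ∀ c, x * c * y = 0) : x = 0 ∨ y = 0 := by
  let W : TwoSidedIdeal A := .mk' {b | ∀ c, x * c * b = 0}
    (fun c => mul_zero _)
    (fun ha hb c => by rw [mul_add, ha c, hb c, add_zero])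
    (fun ha c => by rw [mul_neg, ha c, neg_zero])
    (fun {d b} hb c => by
      rw [show x * c * (d * b) = x * (c * d) * b by simp only [mul_assoc]]; exact hb _)
    (fun ha c => by rw [← mul_assoc, ha c, zero_mul])
  have hW : ∀ b, b ∈ W ↔ ∀ c, x * c * b = 0 := fun b => TwoSidedIdeal.mem_mk' ..
  let V : TwoSidedIdeal A := .mk' {b | ∀ w ∈ W, b * w = 0}
    (fun w _ => zero_mul _)
    (fun ha hb w hw => by rw [add_mul, ha w hw, hb w hw, add_zero])
    (fun ha w hw => by rw [neg_mul, ha w hw, neg_zero])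
    (fun ha w hw => by rw [mul_assoc, ha w hw, mul_zero])
    (fun ha w hw => by rw [mul_assoc]; exact ha _ (W.mul_mem_left _ _ hw))
  have hV : ∀ b, b ∈ V ↔ ∀ w ∈ W, b * w = 0 := fun b => TwoSidedIdeal.mem_mk' ..
  -- Without a unity, `V = 0` only yields `x * c = 0` for all `c`; the left annihilator `Z` of the
  -- ring handles this case.
  let Z : TwoSidedIdeal A := .mk' {b | ∀ c, b * c = 0}
    (fun c => zero_mul _)
    (fun ha hb c => by rw [add_mul, ha c, hb c, add_zero])
    (fun ha c => by rw [neg_mul, ha c, neg_zero])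
    (fun ha c => by rw [mul_assoc, ha c, mul_zero])
    (fun ha c => by rw [mul_assoc]; exact ha _)
  have hZ : ∀ b, b ∈ Z ↔ ∀ c, b * c = 0 := fun b => TwoSidedIdeal.mem_mk' ..
  rcases hA V W fun a ha b hb => (hV a).1 ha b hb with hbot | hbot
  · have hxZ : x ∈ Z := (hZ x).2 fun c => by
      rw [← TwoSidedIdeal.mem_bot, ← hbot, hV]
      exact fun w hw => (hW w).1 hw c
    left
    rcases hA Z ⊤ fun a ha b _ => (hZ a).1 ha b with hbot | hbot
    · rwa [← TwoSidedIdeal.mem_bot, ← hbot]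
    · rw [← TwoSidedIdeal.mem_bot, ← hbot]
      exact TwoSidedIdeal.mem_top A
  · right
    rw [← TwoSidedIdeal.mem_bot, ← hbot, hW]
    exact h

/-- The kernel of a surjection onto a prime ring is a prime ideal or the whole ring. -/
theorem IsPrimeRng.isPrimeIdeal_ker {A : Type u} [Ring A] {B : Type u} [NonUnitalRing B]
    (hB : IsPrimeRng B) (f : A →ₙ+* B) (hf : Function.Surjective f)
    (hne : TwoSidedIdeal.ker f ≠ ⊤) : IsPrimeIdeal (TwoSidedIdeal.ker f) := by
  refine ⟨hne, fun I J hIJ => ?_⟩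
  by_contra! hcon
  obtain ⟨⟨x, hx, hxf⟩, y, hy, hyf⟩ := And.imp SetLike.not_le_iff_exists.1
    SetLike.not_le_iff_exists.1 hcon
  rw [TwoSidedIdeal.mem_ker] at hxf hyf
  refine (hB.eq_zero_or_eq_zero (x := f x) (y := f y) fun c => ?_).elim hxf hyf
  obtain ⟨a, rfl⟩ := hf c
  rw [← map_mul, ← map_mul, ← TwoSidedIdeal.mem_ker]
  exact hIJ _ (I.mul_mem_right _ _ hx) _ hy

/-! ### Contraction of primes along a homomorphism -/

section Contraction

variable {A B : Type u} [Ring A] [Ring B] (φ : A →+* B)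

/-- Ideals maximal with contraction inside a given prime are prime. -/
theorem IsPrimeIdeal.exists_comap_le {P : TwoSidedIdeal A} (hP : IsPrimeIdeal P)
    (I₀ : TwoSidedIdeal B) (hI₀ : ∀ a, φ a ∈ I₀ → a ∈ P) :
    ∃ Q : TwoSidedIdeal B, IsPrimeIdeal Q ∧ I₀ ≤ Q ∧ (∀ a, φ a ∈ Q → a ∈ P) ∧
      ∀ J : TwoSidedIdeal B, Q ≤ J → (∀ a, φ a ∈ J → a ∈ P) → J ≤ Q := by
  have conv : ∀ I : TwoSidedIdeal B,
      (∀ b ∈ I, b ∉ φ '' {a | a ∉ P}) ↔ ∀ a, φ a ∈ I → a ∈ P := by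
    intro I
    constructor
    · intro h a ha
      by_contra haP
      exact h _ ha ⟨a, haP, rfl⟩
    · rintro h _ hb ⟨a, haP, rfl⟩
      exact haP (h a hb)
  obtain ⟨Q, h₁, h₂, h₃, h₄⟩ := exists_isPrimeIdeal_disjoint (φ '' {a | a ∉ P})
    (by
      by_contra hemp
      refine hP.ne_top (top_le_iff.1 fun a _ => ?_)
      by_contra ha
      exact hemp ⟨φ a, a, ha, rfl⟩)
    (by
      rintro I J ⟨_, hi, a, ha, rfl⟩ ⟨_, hj, b, hb, rfl⟩
      by_contra! hcon
      rcases hP.le_or_le (I.comap φ) (J.comap φ) (fun x hx y hy => by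
        by_contra hxy
        refine hcon (φ x) ((TwoSidedIdeal.mem_comap φ).1 hx) (φ y)
          ((TwoSidedIdeal.mem_comap φ).1 hy) ⟨x * y, hxy, map_mul φ x y⟩) with hle | hle
      · exact ha (hle ((TwoSidedIdeal.mem_comap φ).2 hi))
      · exact hb (hle ((TwoSidedIdeal.mem_comap φ).2 hj)))
    I₀ ((conv I₀).2 hI₀)
  exact ⟨Q, h₁, h₂, (conv Q).1 h₃, fun J hJ hJP => h₄ J hJ ((conv J).2 hJP)⟩

/-- A homomorphism `φ : A → B` is surjective modulo primes if it becomes surjective after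
factoring out any prime ideal of `B`. -/
def SurjectiveModPrimes : Prop :=
  ∀ Q : TwoSidedIdeal B, IsPrimeIdeal Q → ∀ b, ∃ a, b - φ a ∈ Q

variable {φ}

namespace SurjectiveModPrimes

/-- Modulo `Q`, each product `φ x * c * φ y` equals some `φ (x * a * y)`, so primeness of `Q` can be
tested on the image of `A`. -/
theorem isPrimeIdeal_comap (hφ : SurjectiveModPrimes φ) {Q : TwoSidedIdeal B}
    (hQ : IsPrimeIdeal Q) : IsPrimeIdeal (Q.comap φ) := by
  refine ⟨fun htop => hQ.ne_top (top_le_iff.1 fun b _ => ?_), fun I J hIJ => ?_⟩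
  · have h1 : (1 : A) ∈ Q.comap φ := htop ▸ TwoSidedIdeal.mem_top A
    rw [TwoSidedIdeal.mem_comap, map_one] at h1
    simpa using Q.mul_mem_left b 1 h1
  · by_contra! hcon
    obtain ⟨⟨x, hx, hxQ⟩, y, hy, hyQ⟩ := And.imp SetLike.not_le_iff_exists.1
      SetLike.not_le_iff_exists.1 hcon
    rw [TwoSidedIdeal.mem_comap] at hxQ hyQ
    refine (hQ.mem_or_mem fun c => ?_).elim hxQ hyQ
    obtain ⟨a, ha⟩ := hφ Q hQ c
    have h := (TwoSidedIdeal.mem_comap φ).1 (hIJ _ (I.mul_mem_right _ a hx) _ hy)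
    rw [map_mul, map_mul] at h
    have h' := Q.mul_mem_right _ (φ y) (Q.mul_mem_left (φ x) _ ha)
    have := Q.add_mem h h'
    rwa [← add_mul, ← mul_add, add_sub_cancel] at this

/-- Going up; for `I₀ = ⊥` this is lying over. -/
theorem exists_comap_eq (hφ : SurjectiveModPrimes φ) {P : TwoSidedIdeal A} (hP : IsPrimeIdeal P)
    (I₀ : TwoSidedIdeal B) (hI₀ : I₀.comap φ ≤ P) :
    ∃ Q : TwoSidedIdeal B, IsPrimeIdeal Q ∧ I₀ ≤ Q ∧ Q.comap φ = P := by
  obtain ⟨Q, hQ, hle, hcomap, hmax⟩ := hP.exists_comap_le φ I₀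
    fun a ha => hI₀ ((TwoSidedIdeal.mem_comap φ).2 ha)
  refine ⟨Q, hQ, hle, le_antisymm (fun a ha => hcomap a ((TwoSidedIdeal.mem_comap φ).1 ha)) ?_⟩
  -- `J = φ(P) + Q` is an ideal because `φ` is onto modulo `Q`. Its contraction is still inside `P`,
  -- so maximality of `Q` forces `φ(P) ⊆ Q`.
  let J : TwoSidedIdeal B := .mk' {b | ∃ a ∈ P, b - φ a ∈ Q}
    ⟨0, P.zero_mem, by simp⟩
    (by
      rintro x y ⟨a, ha, hxa⟩ ⟨b, hb, hyb⟩
      refine ⟨a + b, P.add_mem ha hb, ?_⟩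
      have := Q.add_mem hxa hyb
      rwa [sub_add_sub_comm, ← map_add] at this)
    (by
      rintro x ⟨a, ha, hxa⟩
      refine ⟨-a, P.neg_mem ha, ?_⟩
      have := Q.neg_mem hxa
      rwa [neg_sub', ← map_neg] at this)
    (by
      rintro x y ⟨a, ha, hya⟩
      obtain ⟨c, hc⟩ := hφ Q hQ x
      refine ⟨c * a, P.mul_mem_left _ _ ha, ?_⟩
      have := Q.add_mem (Q.mul_mem_left x _ hya) (Q.mul_mem_right _ (φ a) hc)
      rwa [mul_sub, sub_mul, sub_add_sub_cancel, ← map_mul] at this)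
    (by
      rintro x y ⟨a, ha, hxa⟩
      obtain ⟨c, hc⟩ := hφ Q hQ y
      refine ⟨a * c, P.mul_mem_right _ _ ha, ?_⟩
      have := Q.add_mem (Q.mul_mem_right _ y hxa) (Q.mul_mem_left (φ a) _ hc)
      rwa [mul_sub, sub_mul, sub_add_sub_cancel, ← map_mul] at this)
  have hJ : ∀ b, b ∈ J ↔ ∃ a ∈ P, b - φ a ∈ Q := fun b => TwoSidedIdeal.mem_mk' ..
  have hJQ : J ≤ Q := by
    refine hmax J (fun b hb => (hJ b).2 ⟨0, P.zero_mem, by simpa using hb⟩) fun a ha => ?_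
    obtain ⟨a', ha', h⟩ := (hJ _).1 ha
    rw [← map_sub] at h
    simpa using P.add_mem (hcomap _ h) ha'
  intro a ha
  rw [TwoSidedIdeal.mem_comap]
  exact hJQ ((hJ _).2 ⟨a, ha, by simp⟩)

/-- Contraction of prime ideals. -/
def contract (hφ : SurjectiveModPrimes φ) (Q : PrimeSpec B) : PrimeSpec A :=
  ⟨Q.1.comap φ, hφ.isPrimeIdeal_comap Q.2⟩

theorem contract_strictMono (hφ : SurjectiveModPrimes φ) : StrictMono hφ.contract := by
  intro Q₁ Q₂ h
  refine lt_of_le_not_ge (TwoSidedIdeal.comap_le_comap φ h.le) fun hle => h.not_ge ?_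
  intro b hb
  obtain ⟨a, ha⟩ := hφ Q₁.1 Q₁.2 b
  have h2 : φ a ∈ Q₂.1 := by
    have := Q₂.1.sub_mem hb (h.le ha)
    rwa [sub_sub_cancel] at this
  have h1 : φ a ∈ Q₁.1 := (TwoSidedIdeal.mem_comap φ).1 (hle ((TwoSidedIdeal.mem_comap φ).2 h2))
  simpa using Q₁.1.add_mem ha h1

theorem contract_surjective (hφ : SurjectiveModPrimes φ) (hinj : Function.Injective φ) :
    Function.Surjective hφ.contract := by
  intro P
  obtain ⟨Q, hQ, -, h⟩ := hφ.exists_comap_eq P.2 ⊥ fun a ha => by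
    rw [TwoSidedIdeal.mem_comap, TwoSidedIdeal.mem_bot, map_eq_zero_iff φ hinj] at ha
    exact ha ▸ P.1.zero_mem
  exact ⟨⟨Q, hQ⟩, Subtype.ext h⟩

theorem exists_lt_contract_eq (hφ : SurjectiveModPrimes φ) (Q : PrimeSpec B) (P : PrimeSpec A)
    (h : hφ.contract Q < P) : ∃ Q', Q < Q' ∧ hφ.contract Q' = P := by
  obtain ⟨Q', hQ', hle, heq⟩ := hφ.exists_comap_eq P.2 Q.1 h.le
  have heq' : hφ.contract ⟨Q', hQ'⟩ = P := Subtype.ext heq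
  refine ⟨⟨Q', hQ'⟩, lt_of_le_of_ne hle ?_, heq'⟩
  rintro rfl
  exact h.ne heq'

/-- By strict monotonicity and going up, the primes strictly above a contraction are exactly the
contractions of the primes strictly above `Q`; induct on `d`. -/
theorem contract_mem_primeLevel_iff (hφ : SurjectiveModPrimes φ) (d : WithBot Ordinal.{u}) :
    ∀ Q : PrimeSpec B, hφ.contract Q ∈ primeLevel A d ↔ Q ∈ primeLevel B d := by
  induction d using WellFoundedLT.induction with
  | ind d ih =>
    intro Q
    rw [mem_primeLevel, mem_primeLevel]
    refine and_congr_right fun _ => ⟨fun h Q' hQ' => ?_, fun h P hP => ?_⟩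
    · obtain ⟨b, hb, hmem⟩ := h _ (hφ.contract_strictMono hQ')
      exact ⟨b, hb, (ih b hb Q').1 hmem⟩
    · obtain ⟨Q', hlt, rfl⟩ := hφ.exists_lt_contract_eq Q P hP
      obtain ⟨b, hb, hmem⟩ := h Q' hlt
      exact ⟨b, hb, (ih b hb Q').2 hmem⟩

theorem isClassicalKrullDim_iff (hφ : SurjectiveModPrimes φ) (hinj : Function.Injective φ)
    (d : WithBot Ordinal.{u}) : IsClassicalKrullDim A d ↔ IsClassicalKrullDim B d := by
  have : {c | primeLevel A c = Set.univ} = {c | primeLevel B c = Set.univ} := by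
    ext c
    change primeLevel A c = Set.univ ↔ primeLevel B c = Set.univ
    simp only [Set.eq_univ_iff_forall]
    rw [(hφ.contract_surjective hinj).forall]
    exact forall_congr' (hφ.contract_mem_primeLevel_iff c)
  rw [IsClassicalKrullDim, IsClassicalKrullDim, this]

theorem chainKrullDim_eq (hφ : SurjectiveModPrimes φ) (hinj : Function.Injective φ) :
    chainKrullDim A = chainKrullDim B := by
  rw [chainKrullDim, chainKrullDim, Order.krullDim_eq_iSup_coheight,
    Order.krullDim_eq_iSup_coheight]
  symm
  refine (hφ.contract_surjective hinj).iSup_congr _ fun Q => ?_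
  congr 1
  exact (Order.coheight_eq_of_strictMono _ hφ.contract_strictMono hφ.exists_lt_contract_eq Q).symm

end SurjectiveModPrimes

end Contraction

/-! ### Special radicals -/

/-- Surjections with the same kernel have isomorphic targets. -/
theorem nonempty_ringEquiv_of_ker_eq {A : Type*} {B C : Type u} [NonUnitalRing A]
    [NonUnitalRing B] [NonUnitalRing C] (f : A →ₙ+* B) (g : A →ₙ+* C)
    (hf : Function.Surjective f) (hg : Function.Surjective g)
    (h : ∀ a, f a = 0 ↔ g a = 0) : Nonempty (B ≃+* C) := by
  have key : ∀ a b, f a = f b ↔ g a = g b := fun a b => by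
    rw [← sub_eq_zero, ← map_sub, h, map_sub, sub_eq_zero]
  have hs := Function.surjInv_eq hf
  have hgs : ∀ a, g (Function.surjInv hf (f a)) = g a := fun a => (key _ _).1 (hs _)
  let F : B →ₙ+* C :=
    { toFun := fun b => g (Function.surjInv hf b)
      map_zero' := by rw [← h, hs]
      map_add' := fun x y => by rw [← map_add, ← key, map_add, hs, hs, hs]
      map_mul' := fun x y => by rw [← map_mul, ← key, map_mul, hs, hs, hs] }
  refine ⟨RingEquiv.ofBijective F ⟨fun x y hxy => ?_, fun c => ?_⟩⟩
  · have := (key _ _).2 (show g (Function.surjInv hf x) = g (Function.surjInv hf y) from hxy)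
    rwa [hs, hs] at this
  · obtain ⟨a, rfl⟩ := hg c
    exact ⟨f a, hgs a⟩

/-- The projection onto the quotient by an ideal of a ring without unity. -/
def TwoSidedIdeal.quotientHom {A : Type u} [NonUnitalRing A] (I : TwoSidedIdeal A) :
    A →ₙ+* I.ringCon.Quotient where
  toFun a := (a : I.ringCon.Quotient)
  map_zero' := rfl
  map_add' _ _ := rfl
  map_mul' _ _ := rfl

theorem TwoSidedIdeal.quotientHom_surjective {A : Type u} [NonUnitalRing A]
    (I : TwoSidedIdeal A) : Function.Surjective I.quotientHom :=
  fun x => Quotient.inductionOn' x fun a => ⟨a, rfl⟩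

theorem TwoSidedIdeal.quotientHom_eq_zero_iff {A : Type u} [NonUnitalRing A]
    (I : TwoSidedIdeal A) (a : A) : I.quotientHom a = 0 ↔ a ∈ I :=
  (RingCon.eq I.ringCon (a := a) (b := 0)).trans (I.mem_iff a).symm

/-- The image of an ideal under a surjection. -/
def TwoSidedIdeal.imageOfSurjective {A B : Type u} [NonUnitalRing A] [NonUnitalRing B]
    (f : A →ₙ+* B) (hf : Function.Surjective f) (I : TwoSidedIdeal A) : TwoSidedIdeal B :=
  .mk' (f '' (I : Set A)) ⟨0, I.zero_mem, map_zero f⟩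
    (by
      rintro _ _ ⟨a, ha, rfl⟩ ⟨b, hb, rfl⟩
      exact ⟨a + b, I.add_mem ha hb, map_add f a b⟩)
    (by
      rintro _ ⟨a, ha, rfl⟩
      exact ⟨-a, I.neg_mem ha, map_neg f a⟩)
    (by
      rintro x _ ⟨a, ha, rfl⟩
      obtain ⟨c, rfl⟩ := hf x
      exact ⟨c * a, I.mul_mem_left _ _ ha, map_mul f c a⟩)
    (by
      rintro _ x ⟨a, ha, rfl⟩
      obtain ⟨c, rfl⟩ := hf x
      exact ⟨a * c, I.mul_mem_right _ _ ha, map_mul f a c⟩)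

theorem TwoSidedIdeal.mem_imageOfSurjective {A B : Type u} [NonUnitalRing A] [NonUnitalRing B]
    {f : A →ₙ+* B} {hf : Function.Surjective f} {I : TwoSidedIdeal A} {b : B} :
    b ∈ I.imageOfSurjective f hf ↔ ∃ a ∈ I, f a = b :=
  TwoSidedIdeal.mem_mk' ..

/-- The restriction of a surjection to an ideal, as a map onto the image ideal. -/
def TwoSidedIdeal.toImage {A B : Type u} [NonUnitalRing A] [NonUnitalRing B]
    (f : A →ₙ+* B) (hf : Function.Surjective f) (I : TwoSidedIdeal A) :
    I →ₙ+* I.imageOfSurjective f hf where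
  toFun a := ⟨f a, TwoSidedIdeal.mem_imageOfSurjective.2 ⟨a, a.2, rfl⟩⟩
  map_zero' := Subtype.ext (map_zero f)
  map_add' a b := Subtype.ext (map_add f (a : A) b)
  map_mul' a b := Subtype.ext (map_mul f (a : A) b)

theorem TwoSidedIdeal.toImage_surjective {A B : Type u} [NonUnitalRing A] [NonUnitalRing B]
    (f : A →ₙ+* B) (hf : Function.Surjective f) (I : TwoSidedIdeal A) :
    Function.Surjective (I.toImage f hf) := by
  rintro ⟨b, hb⟩
  obtain ⟨a, ha, rfl⟩ := TwoSidedIdeal.mem_imageOfSurjective.1 hb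
  exact ⟨⟨a, ha⟩, rfl⟩

/-- The kernel of a surjection from an ideal `D` of `A` onto a prime ring absorbs
multiplication by `A`. -/
theorem IsPrimeRng.map_mul_eq_zero {A B : Type u} [NonUnitalRing A] [NonUnitalRing B]
    (hB : IsPrimeRng B) {D : TwoSidedIdeal A} (f : D →ₙ+* B) (hf : Function.Surjective f)
    (k : D) (hk : f k = 0) (c : A) :
    f ⟨c * k, D.mul_mem_left _ _ k.2⟩ = 0 ∧ f ⟨k * c, D.mul_mem_right _ _ k.2⟩ = 0 := by
  constructor
  -- `c` need not lie in `D`, but `(c k) d (c k) = (c k d c) k` with `c k d c ∈ D`, so `f` can be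
  -- split there.
  · refine or_self_iff.1 (hB.eq_zero_or_eq_zero fun b => ?_)
    obtain ⟨d, rfl⟩ := hf b
    rw [← map_mul, ← map_mul, show (⟨c * k, D.mul_mem_left _ _ k.2⟩ * d *
      ⟨c * k, D.mul_mem_left _ _ k.2⟩ : D) =
        ⟨c * k * d * c, D.mul_mem_right _ _ (D.mul_mem_left _ _ d.2)⟩ * k from
      Subtype.ext (by change c * k * d * (c * k) = c * k * d * c * k; simp only [mul_assoc]),
      map_mul, hk, mul_zero]
  · refine or_self_iff.1 (hB.eq_zero_or_eq_zero fun b => ?_)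
    obtain ⟨d, rfl⟩ := hf b
    rw [← map_mul, ← map_mul, show (⟨k * c, D.mul_mem_right _ _ k.2⟩ * d *
      ⟨k * c, D.mul_mem_right _ _ k.2⟩ : D) =
        k * ⟨c * d * (k * c), D.mul_mem_right _ _ (D.mul_mem_left _ _ d.2)⟩ from
      Subtype.ext (by change k * c * d * (k * c) = k * (c * d * (k * c)); simp only [mul_assoc]),
      map_mul, hk, zero_mul]

/-- A surjection of an ideal `D` of `A` onto a member of a special class vanishes as soon as every
surjection of `A` onto a member of the class vanishes on `D`. -/
theorem IsSpecialClass.map_eq_zero_of_ideal {M : RingClass.{u}} (hM : IsSpecialClass M)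
    {A B : Type u} [NonUnitalRing A] [NonUnitalRing B] (D : TwoSidedIdeal A)
    (hD : ∀ (C : Type u) [NonUnitalRing C] (g : A →ₙ+* C), Function.Surjective g → M C →
      ∀ a ∈ D, g a = 0)
    (f : D →ₙ+* B) (hf : Function.Surjective f) (hB : M B) (d : D) : f d = 0 := by
  have hprime := hM.prime B hB
  -- `L` is an ideal of `A` with `L ∩ D = ker f`, so the image of `D` in `A/L` is a copy of `B`.
  -- That image is essential, hence `A/L` is in `M` and `hD` gives `D ⊆ L`.
  let L : TwoSidedIdeal A := .mk' {a | ∀ d : D, f ⟨a * d, D.mul_mem_left _ _ d.2⟩ = 0 ∧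
      f ⟨d * a, D.mul_mem_right _ _ d.2⟩ = 0}
    (fun d => by
      simp only [zero_mul, mul_zero]
      exact ⟨map_zero f, map_zero f⟩)
    (fun {x y} hx hy d => by
      refine ⟨?_, ?_⟩
      · refine Eq.trans ?_ ((congrArg₂ (· + ·) (hx d).1 (hy d).1).trans (add_zero 0))
        exact (congrArg f (Subtype.ext (add_mul x y (d : A)))).trans (map_add f _ _)
      · refine Eq.trans ?_ ((congrArg₂ (· + ·) (hx d).2 (hy d).2).trans (add_zero 0))
        exact (congrArg f (Subtype.ext (mul_add (d : A) x y))).trans (map_add f _ _))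
    (fun {x} hx d => by
      refine ⟨?_, ?_⟩
      · rw [← neg_zero, ← (hx d).1, ← map_neg]
        exact congrArg f (Subtype.ext (neg_mul x (d : A)))
      · rw [← neg_zero, ← (hx d).2, ← map_neg]
        exact congrArg f (Subtype.ext (mul_neg (d : A) x)))
    (fun {x y} hy d => by
      refine ⟨?_, ?_⟩
      · have := (hprime.map_mul_eq_zero f hf _ (hy d).1 x).1
        simpa only [mul_assoc] using this
      · have := (hy ⟨d * x, D.mul_mem_right _ _ d.2⟩).2
        simpa only [mul_assoc] using this)
    (fun {x y} hx d => by
      refine ⟨?_, ?_⟩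
      · have := (hx ⟨y * d, D.mul_mem_left _ _ d.2⟩).1
        simpa only [mul_assoc] using this
      · have := (hprime.map_mul_eq_zero f hf _ (hx d).2 y).2
        simpa only [mul_assoc] using this)
  have hL : ∀ a, a ∈ L ↔ ∀ d : D, f ⟨a * d, D.mul_mem_left _ _ d.2⟩ = 0 ∧
      f ⟨d * a, D.mul_mem_right _ _ d.2⟩ = 0 := fun a => TwoSidedIdeal.mem_mk' ..
  have hLD : ∀ d : D, f d = 0 ↔ (d : A) ∈ L := by
    intro d
    rw [hL]
    refine ⟨fun h d' => ⟨(hprime.map_mul_eq_zero f hf d h d').2,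
      (hprime.map_mul_eq_zero f hf d h d').1⟩, fun h => ?_⟩
    refine or_self_iff.1 (hprime.eq_zero_or_eq_zero fun b => ?_)
    obtain ⟨d', rfl⟩ := hf b
    rw [← map_mul, show f (d * d') = 0 from (h d').1, zero_mul]
  have hsurj := L.quotientHom_surjective
  have hMD : M (D.imageOfSurjective L.quotientHom hsurj) := by
    obtain ⟨e⟩ := nonempty_ringEquiv_of_ker_eq f (D.toImage L.quotientHom hsurj) hf
      (D.toImage_surjective _ hsurj) fun a => by
        rw [hLD, ← L.quotientHom_eq_zero_iff]
        exact (Subtype.ext_iff (a1 := D.toImage L.quotientHom hsurj a) (a2 := 0)).symm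
    exact hM.iso _ _ e hB
  have hess : IsEssentialIdeal (D.imageOfSurjective L.quotientHom hsurj) := by
    intro J hJ
    refine le_bot_iff.1 fun x hx => ?_
    obtain ⟨a, rfl⟩ := hsurj x
    rw [TwoSidedIdeal.mem_bot, L.quotientHom_eq_zero_iff, hL]
    have key : ∀ y : D, L.quotientHom y ∈ J → f y = 0 := by
      intro y hy
      rw [hLD, ← L.quotientHom_eq_zero_iff, ← TwoSidedIdeal.mem_bot, ← hJ]
      exact (TwoSidedIdeal.mem_inf _).2 ⟨hy, TwoSidedIdeal.mem_imageOfSurjective.2 ⟨y, y.2, rfl⟩⟩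
    intro d
    refine ⟨key _ ?_, key _ ?_⟩
    · rw [map_mul]
      exact J.mul_mem_right _ _ hx
    · rw [map_mul]
      exact J.mul_mem_left _ _ hx
  rw [hLD, ← L.quotientHom_eq_zero_iff]
  exact hD _ L.quotientHom hsurj (hM.essential _ _ hess hMD) d d.2

/-- The radical of `A` with respect to a special class is the intersection of the kernels of all
surjections of `A` onto members of the class. -/
theorem IsSpecialClass.mem_radicalIdeal_iff {M : RingClass.{u}} (hM : IsSpecialClass M)
    {A : Type u} [NonUnitalRing A] (a : A) :
    a ∈ radicalIdeal (upperRadical M) A ↔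
      ∀ (B : Type u) [NonUnitalRing B] (f : A →ₙ+* B), Function.Surjective f → M B → f a = 0 := by
  constructor
  · intro ha B _ f hf hB
    rw [← TwoSidedIdeal.mem_ker]
    refine (sSup_le (a := TwoSidedIdeal.ker f) fun I hI => ?_ :
      radicalIdeal (upperRadical M) A ≤ TwoSidedIdeal.ker f) ha
    intro x hx
    -- The image of `I` is an ideal of `B`, hence in `M` by heredity; as `I` is a radical ring, this
    -- image is zero.
    have := hI _ (I.toImage f hf) (I.toImage_surjective f hf) (hM.hereditary _ _ hB)
    rw [TwoSidedIdeal.mem_ker]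
    exact congrArg Subtype.val
      (Subsingleton.elim (I.toImage f hf ⟨x, hx⟩) 0)
  · intro ha
    let D : TwoSidedIdeal A := .mk' {a | ∀ (B : Type u) [NonUnitalRing B] (f : A →ₙ+* B),
        Function.Surjective f → M B → f a = 0}
      (fun B _ f _ _ => map_zero f)
      (fun hx hy B _ f hf hB => by rw [map_add, hx B f hf hB, hy B f hf hB, add_zero])
      (fun hx B _ f hf hB => by rw [map_neg, hx B f hf hB, neg_zero])
      (fun hx B _ f hf hB => by rw [map_mul, hx B f hf hB, mul_zero])
      (fun hx B _ f hf hB => by rw [map_mul, hx B f hf hB, zero_mul])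
    have hD : ∀ a, a ∈ D ↔ ∀ (B : Type u) [NonUnitalRing B] (f : A →ₙ+* B),
        Function.Surjective f → M B → f a = 0 := fun a => TwoSidedIdeal.mem_mk' ..
    refine (le_sSup (a := D) ?_ : D ≤ radicalIdeal (upperRadical M) A) ((hD a).2 ha)
    intro B _ f hf hB
    have h0 : ∀ b : B, b = 0 := by
      intro b
      obtain ⟨d, rfl⟩ := hf b
      exact hM.map_eq_zero_of_ideal D (fun C _ g hg hC x hx => (hD x).1 hx C g hg hC) f hf hB d
    exact ⟨fun x y => by rw [h0 x, h0 y]⟩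

/-- A surjection from `B` with prime kernel stays onto when composed with `φ`; conversely, a prime
kernel in `A` is contracted from some `Q`, and `B/Q` is isomorphic to the same target. Kernels equal
to the whole ring are trivial. -/
theorem SurjectiveModPrimes.mem_radicalIdeal_iff {A B : Type u} [Ring A] [Ring B] {φ : A →+* B}
    (hφ : SurjectiveModPrimes φ) (hinj : Function.Injective φ) {M : RingClass.{u}}
    (hM : IsSpecialClass M) (a : A) :
    a ∈ radicalIdeal (upperRadical M) A ↔ φ a ∈ radicalIdeal (upperRadical M) B := by
  rw [hM.mem_radicalIdeal_iff, hM.mem_radicalIdeal_iff]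
  constructor
  · intro h C _ g hg hC
    by_cases htop : TwoSidedIdeal.ker g = ⊤
    · rw [← TwoSidedIdeal.mem_ker, htop]
      exact TwoSidedIdeal.mem_top B
    · have hker := (hM.prime C hC).isPrimeIdeal_ker g hg htop
      refine h C (g.comp φ.toNonUnitalRingHom) (fun c => ?_) hC
      obtain ⟨b, rfl⟩ := hg c
      obtain ⟨x, hx⟩ := hφ _ hker b
      rw [TwoSidedIdeal.mem_ker, map_sub, sub_eq_zero] at hx
      exact ⟨x, hx.symm⟩
  · intro h C _ f hf hC
    by_cases htop : TwoSidedIdeal.ker f = ⊤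
    · rw [← TwoSidedIdeal.mem_ker, htop]
      exact TwoSidedIdeal.mem_top A
    · have hker := (hM.prime C hC).isPrimeIdeal_ker f hf htop
      obtain ⟨⟨Q, hQ⟩, hcontr⟩ := hφ.contract_surjective hinj ⟨_, hker⟩
      have hcomap : Q.comap φ = TwoSidedIdeal.ker f := congrArg Subtype.val hcontr
      have hmem : ∀ x, f x = 0 ↔ Q.quotientHom (φ x) = 0 := fun x => by
        rw [← TwoSidedIdeal.mem_ker, ← hcomap, TwoSidedIdeal.mem_comap,
          Q.quotientHom_eq_zero_iff]
      rw [hmem]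
      obtain ⟨e⟩ := nonempty_ringEquiv_of_ker_eq f (Q.quotientHom.comp φ.toNonUnitalRingHom) hf
        (fun c => by
          obtain ⟨b, rfl⟩ := Q.quotientHom_surjective c
          obtain ⟨x, hx⟩ := hφ Q hQ b
          rw [← Q.quotientHom_eq_zero_iff, map_sub, sub_eq_zero] at hx
          exact ⟨x, hx.symm⟩) hmem
      exact h _ Q.quotientHom Q.quotientHom_surjective (hM.iso _ _ e hC)

/-! ### Von Neumann regular rings -/

/-- If `a ≠ 0`, then `a * x` is a nonzero idempotent, and an ideal maximal among those avoiding it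
is prime. -/
theorem IsVonNeumannRegular.eq_zero_of_mem_isPrimeIdeal {A : Type u} [Ring A]
    (hA : IsVonNeumannRegular A) {a : A} (ha : ∀ P : TwoSidedIdeal A, IsPrimeIdeal P → a ∈ P) :
    a = 0 := by
  by_contra ha0
  obtain ⟨x, hx⟩ := hA a
  have hidem : a * x * (a * x) = a * x := by rw [← mul_assoc, hx]
  obtain ⟨Q, hQ, -, hdis, -⟩ := exists_isPrimeIdeal_disjoint {a * x} ⟨_, rfl⟩
    (by
      rintro I J ⟨_, hI, rfl⟩ ⟨_, hJ, rfl⟩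
      exact ⟨_, hI, _, hJ, hidem⟩) ⊥
    (by
      intro b hb hbX
      rw [TwoSidedIdeal.mem_bot] at hb
      have h0 : a * x = 0 := (Set.mem_singleton_iff.1 hbX).symm.trans hb
      rw [h0, zero_mul] at hx
      exact ha0 hx.symm)
  exact hdis _ (Q.mul_mem_right _ _ (ha Q hQ)) rfl

/-- If `x` agrees with elements of `R` locally, on finitely many central elements `f` with trivial
common annihilator, and `a x a = a`, then `a r a = a` for some `r ∈ R`. -/
theorem exists_mul_mul_eq_of_local {S : Type u} [Ring S] (R : Subring S) (a x : S)
    (ha : a ∈ R) (hx : a * x * a = a) (l : List (S × S))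
    (hcen : ∀ p ∈ l, p.1 ∈ Subring.center S) (hR : ∀ p ∈ l, p.2 ∈ R)
    (hloc : ∀ p ∈ l, x * p.1 = p.2 * p.1)
    (hann : ∀ y, (∀ p ∈ l, y * p.1 = 0) → y = 0) :
    ∃ r ∈ R, a * r * a = a := by
  suffices h : ∃ r ∈ R, ∀ p ∈ l, (a - a * r * a) * p.1 = 0 by
    obtain ⟨r, hr, h⟩ := h
    exact ⟨r, hr, (sub_eq_zero.1 (hann _ h)).symm⟩
  clear hann
  induction l with
  | nil => exact ⟨0, R.zero_mem, by simp⟩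
  | cons p l ih =>
    obtain ⟨r, hr, h⟩ := ih (fun q hq => hcen q (List.mem_cons_of_mem _ hq))
      (fun q hq => hR q (List.mem_cons_of_mem _ hq))
      (fun q hq => hloc q (List.mem_cons_of_mem _ hq))
    have hpR := hR p List.mem_cons_self
    -- With `s = p.2` and `r'` this witness, the errors multiply: `a - a r' a = (a - a s a)(1 - r a)
    -- = (1 - a s)(a - a r a)`. So `r'` works wherever `s` or `r` does.
    refine ⟨r + p.2 - p.2 * a * r,
      R.sub_mem (R.add_mem hr hpR) (R.mul_mem (R.mul_mem hpR ha) hr), fun q hq => ?_⟩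
    rcases List.mem_cons.1 hq with rfl | hq
    · have hc : ∀ s, s * q.1 = q.1 * s := Subring.mem_center_iff.1 (hcen q List.mem_cons_self)
      have h1 : (a - a * q.2 * a) * q.1 = 0 := by
        have h2 : a * (x * q.1) * a = a * (q.2 * q.1) * a := by
          rw [hloc q List.mem_cons_self]
        rw [sub_mul, sub_eq_zero, mul_assoc _ a, hc a, ← mul_assoc, mul_assoc a q.2, ← h2,
          mul_assoc, mul_assoc, ← hc a, ← mul_assoc, ← mul_assoc, hx, hc a]
      calc (a - a * (r + q.2 - q.2 * a * r) * a) * q.1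
          = (a - a * q.2 * a) * ((1 - r * a) * q.1) := by noncomm_ring
        _ = (a - a * q.2 * a) * q.1 * (1 - r * a) := by rw [mul_assoc _ q.1, ← hc]
        _ = 0 := by rw [h1, zero_mul]
    · calc (a - a * (r + p.2 - p.2 * a * r) * a) * q.1
          = (1 - a * p.2) * ((a - a * r * a) * q.1) := by noncomm_ring
        _ = 0 := by rw [h q hq, mul_zero]

/-- Elements of a ring generated by a subring `R` and central idempotents agree
with elements of `R` locally. -/
theorem exists_local_of_mem_closure {S : Type u} [Ring S] (R : Subring S) (E : Set S)
    (hE : ∀ e ∈ E, e ∈ Subring.center S ∧ IsIdempotentElem e) {x : S}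
    (hx : x ∈ Subring.closure ((R : Set S) ∪ E)) :
    ∃ l : List (S × S), (∀ p ∈ l, p.1 ∈ Subring.center S) ∧ (∀ p ∈ l, p.2 ∈ R) ∧
      (∀ p ∈ l, x * p.1 = p.2 * p.1) ∧ ∀ y, (∀ p ∈ l, y * p.1 = 0) → y = 0 := by
  have combine : ∀ (op : S → S → S), (∀ a b, a ∈ R → b ∈ R → op a b ∈ R) →
      (∀ x y r s f g : S, f ∈ Subring.center S → g ∈ Subring.center S → x * f = r * f →
        y * g = s * g → op x y * (f * g) = op r s * (f * g)) →
      ∀ x y, (∃ l : List (S × S), (∀ p ∈ l, p.1 ∈ Subring.center S) ∧ (∀ p ∈ l, p.2 ∈ R) ∧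
        (∀ p ∈ l, x * p.1 = p.2 * p.1) ∧ ∀ y, (∀ p ∈ l, y * p.1 = 0) → y = 0) →
      (∃ l : List (S × S), (∀ p ∈ l, p.1 ∈ Subring.center S) ∧ (∀ p ∈ l, p.2 ∈ R) ∧
        (∀ p ∈ l, y * p.1 = p.2 * p.1) ∧ ∀ y, (∀ p ∈ l, y * p.1 = 0) → y = 0) →
      ∃ l : List (S × S), (∀ p ∈ l, p.1 ∈ Subring.center S) ∧ (∀ p ∈ l, p.2 ∈ R) ∧
        (∀ p ∈ l, op x y * p.1 = p.2 * p.1) ∧ ∀ y, (∀ p ∈ l, y * p.1 = 0) → y = 0 := by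
    rintro op hop hloc x y ⟨l, l1, l2, l3, l4⟩ ⟨m, m1, m2, m3, m4⟩
    have mem : ∀ {P : S × S → Prop}, (∀ p ∈ l, ∀ q ∈ m, P (p.1 * q.1, op p.2 q.2)) →
        ∀ z ∈ (l.product m).map fun t => (t.1.1 * t.2.1, op t.1.2 t.2.2), P z := by
      intro P h z hz
      obtain ⟨⟨p, q⟩, hpq, rfl⟩ := List.mem_map.1 hz
      exact h p (List.mem_product.1 hpq).1 q (List.mem_product.1 hpq).2
    -- Common refinement of the two families: an element killed by every `f * g` is killed by every
    -- `f`, hence zero.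
    refine ⟨(l.product m).map fun t => (t.1.1 * t.2.1, op t.1.2 t.2.2),
      mem fun p hp q hq => mul_mem (l1 p hp) (m1 q hq),
      mem fun p hp q hq => hop _ _ (l2 p hp) (m2 q hq),
      mem fun p hp q hq => hloc _ _ _ _ _ _ (l1 p hp) (m1 q hq) (l3 p hp) (m3 q hq),
      fun z hz => l4 z fun p hp => m4 _ fun q hq => ?_⟩
    rw [mul_assoc]
    exact hz _ (List.mem_map.2 ⟨(p, q), List.mem_product.2 ⟨hp, hq⟩, rfl⟩)
  have combine_mul := combine (· * ·) (fun _ _ => R.mul_mem) (by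
      intro x y r s f g hf _ hx hy
      have hf' := Subring.mem_center_iff.1 hf
      calc x * y * (f * g) = x * (y * f) * g := by simp only [mul_assoc]
        _ = (x * f) * (y * g) := by rw [hf' y]; simp only [mul_assoc]
        _ = r * (f * s) * g := by rw [hx, hy]; simp only [mul_assoc]
        _ = r * s * (f * g) := by rw [← hf' s]; simp only [mul_assoc])
  have single : ∀ r ∈ R, ∃ l : List (S × S), (∀ p ∈ l, p.1 ∈ Subring.center S) ∧
      (∀ p ∈ l, p.2 ∈ R) ∧ (∀ p ∈ l, r * p.1 = p.2 * p.1) ∧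
      ∀ y, (∀ p ∈ l, y * p.1 = 0) → y = 0 := fun r hr =>
    ⟨[(1, r)], by simp [one_mem], by simpa using hr, by simp, by simp⟩
  induction hx using Subring.closure_induction with
  | mem x hx =>
    rcases hx with hx | hx
    · exact single x hx
    · obtain ⟨hc, hi⟩ := hE x hx
      -- A central idempotent is 1 on its own piece and 0 on the complementary one.
      refine ⟨[(x, 1), (1 - x, 0)], ?_, ?_, ?_, ?_⟩
      · simpa using ⟨hc, sub_mem (one_mem _) hc⟩
      · simp [one_mem, zero_mem]
      · simp [mul_sub, hi.eq]
      · intro y hy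
        have h1 := hy (x, 1) (by simp)
        have h2 := hy (1 - x, 0) (by simp)
        simpa [mul_sub, h1] using h2
  | zero => exact single 0 R.zero_mem
  | one => exact single 1 R.one_mem
  | add x y _ _ hx hy =>
    refine combine (· + ·) (fun _ _ => R.add_mem) ?_ x y hx hy
    intro x y r s f g hf _ hx hy
    have hfg : f * g = g * f := (Subring.mem_center_iff.1 hf g).symm
    simp only [add_mul]
    rw [← mul_assoc x, hx, mul_assoc, hfg, ← mul_assoc y, hy, mul_assoc s]
  | mul x y _ _ hx hy =>
    exact combine_mul x y hx hy
  | neg x _ hx =>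
    obtain ⟨l, l1, l2, l3, l4⟩ := combine_mul (-1) x (single _ (R.neg_mem R.one_mem)) hx
    exact ⟨l, l1, l2, fun p hp => by simpa using l3 p hp, l4⟩

/-! ### Adjoining idempotents that are central modulo the prime radical -/

/-- Primes of a subring contain the commutators of its elements with idempotents of the overring
that are central modulo the prime radical. -/
theorem commutator_mem_isPrimeIdeal {T : Type u} [Ring T] {S : Subring T} {e s : S}
    (he : (e : T) ∈ centralModPrimeRadical T) {Q : TwoSidedIdeal S} (hQ : IsPrimeIdeal Q) :
    s * e - e * s ∈ Q := by
  obtain ⟨Q', hQ', -, hcomap, -⟩ := hQ.exists_comap_le S.subtype ⊥ fun a ha => by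
    rw [TwoSidedIdeal.mem_bot, map_eq_zero_iff _ S.subtype_injective] at ha
    exact ha ▸ Q.zero_mem
  refine hcomap _ ?_
  have hcen := Subring.mem_center_iff.1 he.2 ((primeRadical T).ringCon.mk' (s : T))
  rw [← map_mul, ← map_mul] at hcen
  have hmem : (s : T) * e - e * s ∈ primeRadical T := by
    rw [← TwoSidedIdeal.rel_iff]
    exact (RingCon.eq _).1 hcen
  exact (sInf_le (a := Q') hQ' : primeRadical T ≤ Q') hmem

/-- Elements congruent modulo `Q` to elements of `R` form a subring. It contains each `e ∈ E`, since
`e S (1 - e) ⊆ Q` puts `e` or `1 - e` in `Q`. -/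
theorem surjectiveModPrimes_inclusion {T : Type u} [Ring T] {R S : Subring T} {E : Set T}
    (hE : E ⊆ centralModPrimeRadical T) (hS : S = Subring.closure ((R : Set T) ∪ E))
    (hRS : R ≤ S) : SurjectiveModPrimes (Subring.inclusion hRS) := by
  intro Q hQ
  have hall : ∀ b (hb : b ∈ Subring.closure ((R : Set T) ∪ E)),
      ∃ a : R, (⟨b, hS ▸ hb⟩ : S) - Subring.inclusion hRS a ∈ Q := by
    intro b hb
    induction hb using Subring.closure_induction with
    | mem x hx =>
      rcases hx with hx | hx
      · refine ⟨⟨x, hx⟩, ?_⟩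
        convert Q.zero_mem using 1
        exact sub_self _
      · have hxS : x ∈ S := hS ▸ Subring.subset_closure (Or.inr hx)
        have hidem : (⟨x, hxS⟩ : S) * ⟨x, hxS⟩ = ⟨x, hxS⟩ := Subtype.ext (hE hx).1
        rcases hQ.mem_or_mem (x := ⟨x, hxS⟩) (y := 1 - ⟨x, hxS⟩) (fun c => by
          have h := Q.mul_mem_left (-⟨x, hxS⟩) _
            (commutator_mem_isPrimeIdeal (e := ⟨x, hxS⟩) (s := c) (hE hx) hQ)
          have heq : (⟨x, hxS⟩ : S) * c * (1 - ⟨x, hxS⟩) =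
              -⟨x, hxS⟩ * (c * ⟨x, hxS⟩ - ⟨x, hxS⟩ * c) := by
            rw [mul_sub, mul_sub, ← mul_assoc _ _ c, neg_mul _ (⟨x, hxS⟩ : S), hidem]
            noncomm_ring
          rwa [heq]) with h | h
        · exact ⟨0, by simpa using h⟩
        · refine ⟨1, ?_⟩
          have := Q.neg_mem h
          rwa [neg_sub] at this
    | zero =>
      refine ⟨0, ?_⟩
      convert Q.zero_mem using 1
      exact sub_self _
    | one =>
      refine ⟨1, ?_⟩
      convert Q.zero_mem using 1
      exact sub_self _
    | add x y hx hy ihx ihy =>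
      obtain ⟨a, ha⟩ := ihx
      obtain ⟨b, hb⟩ := ihy
      refine ⟨a + b, ?_⟩
      have := Q.add_mem ha hb
      rwa [sub_add_sub_comm, ← map_add] at this
    | neg x hx ihx =>
      obtain ⟨a, ha⟩ := ihx
      refine ⟨-a, ?_⟩
      have := Q.neg_mem ha
      rwa [neg_sub', ← map_neg] at this
    | mul x y hx hy ihx ihy =>
      obtain ⟨a, ha⟩ := ihx
      obtain ⟨b, hb⟩ := ihy
      refine ⟨a * b, ?_⟩
      have := Q.add_mem (Q.mul_mem_left ⟨x, hS ▸ hx⟩ _ hb)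
        (Q.mul_mem_right _ (Subring.inclusion hRS b) ha)
      rwa [mul_sub, sub_mul, sub_add_sub_cancel, ← map_mul] at this
  rintro ⟨b, hb⟩
  exact hall b (hS ▸ hb)

theorem IsVonNeumannRegular.of_closure {T : Type u} [Ring T] {R S : Subring T} {E : Set T}
    (hE : E ⊆ centralModPrimeRadical T) (hS : S = Subring.closure ((R : Set T) ∪ E))
    (hreg : IsVonNeumannRegular S) : IsVonNeumannRegular R := by
  have hRS : R ≤ S := fun r hr => hS ▸ Subring.subset_closure (Or.inl hr)
  rintro ⟨a, ha⟩
  obtain ⟨x, hx⟩ := hreg ⟨a, hRS ha⟩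
  -- The elements of `E` become central only in `S`, so the generation of `S` is restated inside `S`
  -- rather than `T`.
  have hmem : x ∈ Subring.closure
      (((R.comap S.subtype : Subring S) : Set S) ∪ ((↑) ⁻¹' E : Set S)) := by
    have hmap : (Subring.closure (((R.comap S.subtype : Subring S) : Set S) ∪
        ((↑) ⁻¹' E : Set S))).map S.subtype = S := by
      rw [RingHom.map_closure]
      conv_rhs => rw [hS]
      congr 1
      ext t
      constructor
      · rintro ⟨s, hs | hs, rfl⟩
        · exact Or.inl hs
        · exact Or.inr hs
      · rintro (ht | ht)
        · exact ⟨⟨t, hRS ht⟩, Or.inl ht, rfl⟩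
        · exact ⟨⟨t, hS ▸ Subring.subset_closure (Or.inr ht)⟩, Or.inr ht, rfl⟩
    obtain ⟨y, hy, hyx⟩ := Subring.mem_map.1 (hmap.symm ▸ x.2 :
      (x : T) ∈ (Subring.closure (((R.comap S.subtype : Subring S) : Set S) ∪
        ((↑) ⁻¹' E : Set S))).map S.subtype)
    rwa [← Subtype.ext hyx]
  obtain ⟨l, l1, l2, l3, l4⟩ := exists_local_of_mem_closure (R.comap S.subtype) _
    (fun e he => ⟨Subring.mem_center_iff.2 fun s => sub_eq_zero.1
      (hreg.eq_zero_of_mem_isPrimeIdeal fun P hP => commutator_mem_isPrimeIdeal (hE he) hP),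
      Subtype.ext (hE he).1⟩) hmem
  obtain ⟨r, hr, h⟩ := exists_mul_mul_eq_of_local (R.comap S.subtype) ⟨a, hRS ha⟩ x ha hx l
    l1 l2 l3 l4
  exact ⟨⟨r, hr⟩, Subtype.ext (congrArg ((↑) : S → T) h)⟩

theorem theorem1p14 {T : Type u} [Ring T] (R S : Subring T) (E : Set T)
    (hne : E.Nonempty) (hE : E ⊆ centralModPrimeRadical T)
    (hS : S = Subring.closure ((R : Set T) ∪ E)) :
    (∀ ρ : RingClass.{u}, IsSpecialRadical ρ →
      ((↑) : R → T) '' (radicalIdeal ρ R : Set R) =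
        ((↑) : S → T) '' (radicalIdeal ρ S : Set S) ∩ (R : Set T)) ∧
    ((∀ d : WithBot Ordinal.{u}, IsClassicalKrullDim R d ↔ IsClassicalKrullDim S d) ∧
      chainKrullDim R = chainKrullDim S) ∧
    (IsVonNeumannRegular S → IsVonNeumannRegular R) := by
  have hRS : R ≤ S := fun r hr => hS ▸ Subring.subset_closure (Or.inl hr)
  have hφ := surjectiveModPrimes_inclusion hE hS hRS
  have hinj : Function.Injective (Subring.inclusion hRS) := Set.inclusion_injective hRS
  refine ⟨?_, ⟨hφ.isClassicalKrullDim_iff hinj, hφ.chainKrullDim_eq hinj⟩,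
    IsVonNeumannRegular.of_closure hE hS⟩
  rintro _ ⟨M, hM, rfl⟩
  ext t
  constructor
  · rintro ⟨r, hr, rfl⟩
    exact ⟨⟨Subring.inclusion hRS r, (hφ.mem_radicalIdeal_iff hinj hM r).1 hr, rfl⟩, r.2⟩
  · rintro ⟨⟨s, hs, rfl⟩, hsR⟩
    exact ⟨⟨s, hsR⟩, (hφ.mem_radicalIdeal_iff hinj hM ⟨s, hsR⟩).2 hs, rfl⟩
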